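/- Let $\mathbb C^2_*=\mathbb C^2\setminus\{0\}$, let $\mathbb P^1=\mathbb C\cup\{\infty\}$ be the Riemann sphere, and let $\phi(v)=\frac{v+1/2}{1+v/2}$, a Möbius transformation of $\mathbb P^1$ that preserves the unit disc $\Delta=\{|v|<1\}$ and the unit circle $S^1=\{|v|=1\}$. The group $\Gamma=\{\gamma_n : n\in\mathbb Z\}\cong\mathbb Z$ acts freely and properly discontinuously on $\mathbb C^2_*\times\mathbb P^1$ by $\gamma_n\cdot(z,v)=(2^nz,\phi^n(v))$. Let $B=(\mathbb C^2_*\times\mathbb P^1)/\Gamma$ be the quotient complex manifold; it is the total space of a flat $\mathbb P^1$-bundle over the Hopf surface $H=\mathbb C^2_*/\langle z\mapsto 2z\rangle$. Let $\Omega=(\mathbb C^2_*\times\Delta)/\Gamma\subset B$ be the corresponding flat disc bundle and $M=(\mathbb C^2_*\times S^1)/\Gamma\subset B$ the corresponding flat circle bundle. A pseudoconvex domain in a complex manifold $X$ means a connected open set $D\subset X$ such that every boundary point of $D$ has an open neighbourhood $U$, contained in a coordinate domain, for which $U\cap D$ is pseudoconvex, i.e. admits a continuous plurisubharmonic exhaustion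 function. (For $D=X$ there is no condition.) Theorem. (i) $\Omega$ is a domain in $B$, its boundary in $B$ is $M$, and $\overline\Omega=\Omega\cup M$. This boundary is real-analytic and Levi-flat: near every point of $M$ there are holomorphic coordinates and a real-analytic function $\rho$ with $\Omega=\{\rho<0\}$, $M=\{\rho=0\}$ and $d\rho\neq0$ on $M$, such that the Levi form of $\rho$ vanishes on the complex tangent vectors of $M$. (ii) $\overline\Omega$ has no pseudoconvex neighborhood basis in $B$: there is no family of pseudoconvex domains in $B$ containing $\overline\Omega$ such that every open set containing $\overline\Omega$ contains a member of the family. (iii) There does not exist a decreasing sequence $\Omega_1\supseteq\Omega_2\supseteq\cdots$ of pseudoconvex domains in $B$ with $\bigcap_n\Omega_n=\overline\Omega$. -/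

import Mathlib

open scoped Manifold ContDiff

/-! ### The Riemann sphere as a complex manifold -/

namespace RiemannSphere

open OnePoint Filter Topology

/-- The inversion `v ↦ 1 / v` of the Riemann sphere. -/
noncomputable def inv (v : OnePoint ℂ) : OnePoint ℂ :=
  v.elim ((0 : ℂ) : OnePoint ℂ) fun v ↦ if v = 0 then infty else ((v⁻¹ : ℂ) : OnePoint ℂ)

theorem inv_infty : inv infty = ((0 : ℂ) : OnePoint ℂ) := rfl

theorem inv_coe (v : ℂ) : inv v = if v = 0 then infty else ((v⁻¹ : ℂ) : OnePoint ℂ) := rfl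

theorem inv_inv (v : OnePoint ℂ) : inv (inv v) = v := by
  induction v using OnePoint.rec with
  | infty => simp [inv_infty, inv_coe]
  | coe v => by_cases h : v = 0 <;> simp [inv_infty, inv_coe, h]

theorem continuous_inv : Continuous inv := by
  rw [continuous_iff_continuousAt]
  intro v
  induction v using OnePoint.rec with
  | infty =>
    rw [continuousAt_infty', inv_infty, coclosedCompact_eq_cocompact, ← Metric.cobounded_eq_cocompact]
    have h : Tendsto (fun v : ℂ ↦ ((v⁻¹ : ℂ) : OnePoint ℂ)) (Bornology.cobounded ℂ)
        (𝓝 ((0 : ℂ) : OnePoint ℂ)) :=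
      (continuous_coe.tendsto _).comp tendsto_inv₀_cobounded
    refine h.congr' ?_
    filter_upwards [Bornology.eventually_ne_cobounded (0 : ℂ)] with v hv
    simp [inv_coe, hv]
  | coe v =>
    rw [continuousAt_coe]
    by_cases hv : v = 0
    · subst hv
      rw [continuousAt_iff_punctured_nhds]
      have h : Tendsto (fun v : ℂ ↦ ((v⁻¹ : ℂ) : OnePoint ℂ)) (𝓝[≠] 0) (𝓝 infty) := by
        refine (tendsto_coe_infty (X := ℂ)).comp ?_
        rw [coclosedCompact_eq_cocompact, ← Metric.cobounded_eq_cocompact]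
        exact tendsto_inv₀_nhdsNE_zero
      have h0 : (inv ∘ ((↑) : ℂ → OnePoint ℂ)) 0 = infty := by simp [inv_coe]
      rw [h0]
      refine h.congr' ?_
      filter_upwards [self_mem_nhdsWithin] with v hv
      simp [inv_coe, show v ≠ 0 from hv]
    · have h : ContinuousAt (fun v : ℂ ↦ ((v⁻¹ : ℂ) : OnePoint ℂ)) v :=
        continuous_coe.continuousAt.comp (continuousAt_inv₀ hv)
      refine h.congr ?_
      filter_upwards [isOpen_ne.mem_nhds hv] with w hw
      simp [inv_coe, show w ≠ 0 from hw]

/-- The inversion as a homeomorphism. -/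
noncomputable def invHomeo : OnePoint ℂ ≃ₜ OnePoint ℂ where
  toFun := inv
  invFun := inv
  left_inv := inv_inv
  right_inv := inv_inv
  continuous_toFun := continuous_inv
  continuous_invFun := continuous_inv

/-- The affine chart `v ↦ v`, defined away from `∞`. -/
noncomputable def finChart : OpenPartialHomeomorph (OnePoint ℂ) ℂ :=
  (isOpenEmbedding_coe.toOpenPartialHomeomorph ((↑) : ℂ → OnePoint ℂ)).symm

/-- The affine chart `v ↦ 1 / v`, defined away from `0`. -/
noncomputable def inftyChart : OpenPartialHomeomorph (OnePoint ℂ) ℂ :=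
  invHomeo.toOpenPartialHomeomorph.trans finChart

theorem finChart_source : finChart.source = {infty}ᶜ := by
  simp [finChart, ← compl_range_coe]

theorem finChart_target : finChart.target = Set.univ := by simp [finChart]

theorem finChart_symm (v : ℂ) : finChart.symm v = (v : OnePoint ℂ) := by simp [finChart]

theorem finChart_coe (v : ℂ) : finChart (v : OnePoint ℂ) = v := by
  rw [← finChart_symm]; exact finChart.right_inv (by simp [finChart_target])

theorem inftyChart_source : inftyChart.source = {((0 : ℂ) : OnePoint ℂ)}ᶜ := by
  have h : ∀ v, inv v = infty ↔ v = ((0 : ℂ) : OnePoint ℂ) := fun v ↦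
    ⟨fun h ↦ by rw [← inv_inv v, h, inv_infty], fun h ↦ by simp [h, inv_coe]⟩
  ext v
  simp [inftyChart, finChart_source, invHomeo, h]

theorem inftyChart_target : inftyChart.target = Set.univ := by
  simp [inftyChart, finChart_target]

theorem inftyChart_symm (w : ℂ) : inftyChart.symm w = inv w := by
  simp [inftyChart, finChart_symm, invHomeo]

theorem inftyChart_coe (v : ℂ) (hv : v ≠ 0) : inftyChart (v : OnePoint ℂ) = v⁻¹ := by
  simp [inftyChart, invHomeo, inv_coe, hv, finChart_coe]

/-- The standard atlas of the Riemann sphere, with the two affine charts. -/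
noncomputable instance : ChartedSpace ℂ (OnePoint ℂ) where
  atlas := {finChart, inftyChart}
  chartAt v := v.elim inftyChart fun _ ↦ finChart
  mem_chart_source v := by
    induction v using OnePoint.rec with
    | infty => simp [inftyChart_source]
    | coe v => simp [finChart_source]
  chart_mem_atlas v := by
    induction v using OnePoint.rec with
    | infty => simp
    | coe v => simp

theorem chartAt_infty : chartAt ℂ (infty : OnePoint ℂ) = inftyChart := rfl

theorem chartAt_coe (v : ℂ) : chartAt ℂ (v : OnePoint ℂ) = finChart := rfl

instance : IsManifold 𝓘(ℂ) ω (OnePoint ℂ) := by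
  have key : ContDiffOn ℂ ω (fun v : ℂ ↦ v⁻¹) {0}ᶜ := contDiffOn_inv ℂ
  apply isManifold_of_contDiffOn
  rintro e e' (rfl | rfl) (rfl | rfl)
  · refine contDiffOn_id.congr fun v _ ↦ ?_
    simp [finChart_symm, finChart_coe]
  · have hs : ∀ v ∈ (finChart.symm.trans inftyChart).source, v ≠ 0 := by
      intro v hv h
      simp [finChart_symm, inftyChart_source, h] at hv
    simp only [modelWithCornersSelf_coe, modelWithCornersSelf_coe_symm, Set.preimage_id,
      Set.range_id, Set.inter_univ, Function.id_comp, Function.comp_id]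
    refine (key.mono fun v hv ↦ hs v hv).congr fun v hv ↦ ?_
    simp [finChart_symm, inftyChart_coe _ (hs v hv)]
  · have hs : ∀ v ∈ (inftyChart.symm.trans finChart).source, v ≠ 0 := by
      intro v hv h
      simp [inftyChart_symm, finChart_source, h, inv_coe] at hv
    simp only [modelWithCornersSelf_coe, modelWithCornersSelf_coe_symm, Set.preimage_id,
      Set.range_id, Set.inter_univ, Function.id_comp, Function.comp_id]
    refine (key.mono fun v hv ↦ hs v hv).congr fun v hv ↦ ?_
    simp [inftyChart_symm, inv_coe, hs v hv, finChart_coe]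
  · refine contDiffOn_id.congr fun v _ ↦ ?_
    simp only [modelWithCornersSelf_coe, modelWithCornersSelf_coe_symm, Function.comp_apply, id,
      OpenPartialHomeomorph.coe_trans]
    exact inftyChart.right_inv (by simp [inftyChart_target])

theorem contMDiff_coe : ContMDiff 𝓘(ℂ) 𝓘(ℂ) ω ((↑) : ℂ → OnePoint ℂ) := by
  have h := contMDiffOn_symm_of_mem_maximalAtlas (I := 𝓘(ℂ)) (n := ω)
    (IsManifold.subset_maximalAtlas (show finChart ∈ atlas ℂ (OnePoint ℂ) from Or.inl rfl))
  rw [finChart_target, contMDiffOn_univ] at h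
  exact h.congr fun v ↦ (finChart_symm v).symm

theorem contMDiff_inv_coe : ContMDiff 𝓘(ℂ) 𝓘(ℂ) ω (fun w : ℂ ↦ inv (w : OnePoint ℂ)) := by
  have h := contMDiffOn_symm_of_mem_maximalAtlas (I := 𝓘(ℂ)) (n := ω)
    (IsManifold.subset_maximalAtlas (show inftyChart ∈ atlas ℂ (OnePoint ℂ) from Or.inr rfl))
  rw [inftyChart_target, contMDiffOn_univ] at h
  exact h.congr fun v ↦ (inftyChart_symm v).symm

/-- Möbius transformations act holomorphically on the Riemann sphere. -/
theorem contMDiff_smul (g : GL (Fin 2) ℂ) :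
    ContMDiff 𝓘(ℂ) 𝓘(ℂ) ω (fun v : OnePoint ℂ ↦ g • v) := by
  set a := g 0 0 with ha
  set b := g 0 1 with hb
  set c := g 1 0 with hc
  set d := g 1 1 with hd
  have hdet : a * d - b * c ≠ 0 := by
    have := g.det_ne_zero
    rwa [Matrix.det_fin_two] at this
  -- a ratio of holomorphic functions without common zeros is a holomorphic map to the sphere
  have ratio : ∀ (p q : ℂ → ℂ) (x : ℂ) (f : ℂ → OnePoint ℂ), ContDiff ℂ ω p → ContDiff ℂ ω q →
      (p x ≠ 0 ∨ q x ≠ 0) →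
      (∀ y, (p y ≠ 0 ∨ q y ≠ 0) → f y = if q y = 0 then infty else ((p y / q y : ℂ) : OnePoint ℂ)) →
      ContMDiffAt 𝓘(ℂ) 𝓘(ℂ) ω f x := by
    intro p q x f hp hq hx hf
    by_cases hqx : q x = 0
    · have hpx : p x ≠ 0 := hx.resolve_right (not_not.mpr hqx)
      have h1 : ContMDiffAt 𝓘(ℂ) 𝓘(ℂ) ω (fun y ↦ q y / p y) x :=
        (hq.contDiffAt.div hp.contDiffAt hpx).contMDiffAt
      have h2 := (contMDiff_inv_coe (q x / p x)).comp x h1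
      refine h2.congr_of_eventuallyEq ?_
      filter_upwards [hp.continuous.continuousAt.eventually_ne hpx] with y hy
      rw [hf y (Or.inl hy)]
      by_cases hqy : q y = 0 <;> simp [inv_coe, hqy, hy]
    · have h1 : ContMDiffAt 𝓘(ℂ) 𝓘(ℂ) ω (fun y ↦ p y / q y) x :=
        (hp.contDiffAt.div hq.contDiffAt hqx).contMDiffAt
      have h2 := (contMDiff_coe (p x / q x)).comp x h1
      refine h2.congr_of_eventuallyEq ?_
      filter_upwards [hq.continuous.continuousAt.eventually_ne hqx] with y hy
      rw [hf y (Or.inr hy)]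
      simp [hy]
  intro v
  induction v using OnePoint.rec with
  | infty =>
    have h1 : ContMDiffAt 𝓘(ℂ) 𝓘(ℂ) ω (fun w : ℂ ↦ g • inv (w : OnePoint ℂ)) 0 := by
      refine ratio (fun w ↦ a + b * w) (fun w ↦ c + d * w) 0 _ (by fun_prop) (by fun_prop) ?_ ?_
      · by_contra! h
        simp only [mul_zero, add_zero] at h
        apply hdet
        rw [h.1, h.2]
        ring
      · intro w hw
        by_cases h0 : w = 0
        · simp [h0, inv_coe, smul_infty_eq_ite, ← ha, ← hc]
        · simp only [inv_coe, if_neg h0, smul_some_eq_ite, ← ha, ← hb, ← hc, ← hd]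
          have e1 : c * w⁻¹ + d = (c + d * w) / w := by field_simp
          have e2 : a * w⁻¹ + b = (a + b * w) / w := by field_simp
          rw [e1, e2]
          by_cases h2 : c + d * w = 0
          · simp [h2]
          · have h3 : (c + d * w) / w ≠ 0 := div_ne_zero h2 h0
            rw [if_neg h3, if_neg h2, div_div_div_cancel_right₀ h0]
    have h2 : ContMDiffAt 𝓘(ℂ) 𝓘(ℂ) ω inftyChart (infty : OnePoint ℂ) :=
      contMDiffAt_of_mem_maximalAtlas
        (IsManifold.subset_maximalAtlas (show inftyChart ∈ atlas ℂ (OnePoint ℂ) from Or.inr rfl))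
        (by simp [inftyChart_source])
    have h3 : inftyChart (infty : OnePoint ℂ) = 0 := by
      simp [inftyChart, invHomeo, inv_infty, finChart_coe]
    rw [← h3] at h1
    refine (h1.comp _ h2).congr_of_eventuallyEq ?_
    filter_upwards [inftyChart.open_source.mem_nhds (by simp [inftyChart_source])] with y hy
    simp only [Function.comp_apply]
    rw [← inftyChart_symm, inftyChart.left_inv hy]
  | coe v =>
    have h1 : ContMDiffAt 𝓘(ℂ) 𝓘(ℂ) ω (fun w : ℂ ↦ g • (w : OnePoint ℂ)) v := by
      refine ratio (fun w ↦ a * w + b) (fun w ↦ c * w + d) v _ (by fun_prop) (by fun_prop) ?_ ?_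
      · by_contra! h
        apply hdet
        linear_combination (-c) * h.1 + a * h.2
      · intro w _
        rw [smul_some_eq_ite]
    have h2 : ContMDiffAt 𝓘(ℂ) 𝓘(ℂ) ω finChart (v : OnePoint ℂ) :=
      contMDiffAt_of_mem_maximalAtlas
        (IsManifold.subset_maximalAtlas (show finChart ∈ atlas ℂ (OnePoint ℂ) from Or.inl rfl))
        (by simp [finChart_source])
    have h3 : finChart (v : OnePoint ℂ) = v := finChart_coe v
    rw [← h3] at h1
    refine (h1.comp _ h2).congr_of_eventuallyEq ?_
    filter_upwards [finChart.open_source.mem_nhds (by simp [finChart_source])] with y hy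
    simp only [Function.comp_apply]
    rw [← finChart_symm, finChart.left_inv hy]

end RiemannSphere

/-! ### Quotients of manifolds by free and properly discontinuous actions -/

namespace MulAction

open Topology

/-- If the group acts by `C^n` maps, then the quotient charts are `C^n` compatible. -/
theorem isManifold_quotient {𝕜 : Type*} [NontriviallyNormedField 𝕜]
    {E : Type*} [NormedAddCommGroup E] [NormedSpace 𝕜 E] {H : Type*} [TopologicalSpace H]
    (I : ModelWithCorners 𝕜 E H) (n : ℕ∞ω)
    {M : Type*} [TopologicalSpace M] {G : Type*} [Group G] [MulAction G M]
    [ProperlyDiscontinuousSMul G M] [ContinuousConstSMul G M] [IsCancelSMul G M]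
    [T2Space M] [LocallyCompactSpace M] [ChartedSpace H M] [IsManifold I n M]
    (hG : ∀ g : G, ContMDiff I I n (fun x : M ↦ g • x)) :
    IsManifold I n (orbitRel.Quotient G M) := by
  set π : M → orbitRel.Quotient G M := Quotient.mk _ with hπ
  have hcov : IsQuotientCoveringMap π G :=
    isQuotientCoveringMap_quotientMk_of_properlyDiscontinuousSMul
  have hloc : IsLocalHomeomorph π := hcov.isCoveringMap.isLocalHomeomorph
  apply isManifold_of_contDiffOn
  rintro e e' ⟨q, rfl⟩ ⟨q', rfl⟩
  set m₁ : M := Quotient.mk_surjective.hasRightInverse.choose q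
  set m₂ : M := Quotient.mk_surjective.hasRightInverse.choose q'
  change ContDiffOn 𝕜 n (I ∘ ((hloc.localInverseAt m₁).trans (chartAt H m₁)).symm.trans
    ((hloc.localInverseAt m₂).trans (chartAt H m₂)) ∘ I.symm) (I.symm ⁻¹'
      (((hloc.localInverseAt m₁).trans (chartAt H m₁)).symm.trans
        ((hloc.localInverseAt m₂).trans (chartAt H m₂))).source ∩ Set.range I)
  set L₁ := hloc.localInverseAt m₁
  set L₂ := hloc.localInverseAt m₂
  have hL₁ : ∀ x, L₁.symm x = π x := fun x ↦ by
    rw [hloc.localInverseAt_symm]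
  have hL₂ : ∀ x, L₂.symm x = π x := fun x ↦ by
    rw [hloc.localInverseAt_symm]
  rintro x ⟨hx, y, rfl⟩
  simp only [Set.mem_preimage, I.left_inv, OpenPartialHomeomorph.trans_source,
    OpenPartialHomeomorph.symm_source, OpenPartialHomeomorph.trans_target, Set.mem_inter_iff,
    OpenPartialHomeomorph.coe_trans_symm, Function.comp_apply, hL₁] at hx
  obtain ⟨⟨hy₁, hy₂⟩, hy₃, hy₄⟩ := hx
  set m := (chartAt H m₁).symm y with hm
  have hπm : π (L₂ (π m)) = π m := by rw [← hL₂, L₂.left_inv hy₃]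
  obtain ⟨g, hg⟩ := hcov.apply_eq_iff_mem_orbit.mp hπm
  simp only at hg
  -- near `m`, the change of lifts is the action of `g`
  have hev : ∀ᶠ z in 𝓝 m, L₂ (π z) = g • z := by
    have h1 : ∀ᶠ z in 𝓝 m, π z ∈ L₂.source :=
      hloc.continuous.continuousAt.eventually (L₂.open_source.mem_nhds hy₃)
    have h2 : ∀ᶠ z in 𝓝 m, g • z ∈ L₂.target := by
      refine (continuous_const_smul g).continuousAt.eventually (L₂.open_target.mem_nhds ?_)
      change g • m ∈ L₂.target
      rw [hg]
      exact L₂.map_source hy₃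
    filter_upwards [h1, h2] with z hz1 hz2
    have : π z = L₂.symm (g • z) := by rw [hL₂, hcov.map_smul]
    rw [this, L₂.right_inv hz2]
  have hsm := (contMDiffAt_iff_of_mem_maximalAtlas (I := I) (I' := I) (n := n)
    (IsManifold.chart_mem_maximalAtlas m₁) (IsManifold.chart_mem_maximalAtlas m₂)
    ((chartAt H m₁).map_target hy₁) (f := fun z : M ↦ g • z)
    (by change g • m ∈ _; rw [hg]; exact hy₄)).mp
    (hG g m)
  have hxy : (chartAt H m₁).extend I m = I y := by
    simp [hm, (chartAt H m₁).right_inv hy₁]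
  have h3 := hsm.2
  rw [hxy] at h3
  refine (h3.mono Set.inter_subset_right).congr_of_eventuallyEq ?_ ?_
  · have hc : ContinuousAt (fun x ↦ (chartAt H m₁).symm (I.symm x)) (I y) := by
      refine ContinuousAt.comp ?_ I.continuous_symm.continuousAt
      rw [I.left_inv]
      exact (chartAt H m₁).continuousAt_symm hy₁
    have h4 : ∀ᶠ x in 𝓝 (I y), L₂ (π ((chartAt H m₁).symm (I.symm x))) =
        g • (chartAt H m₁).symm (I.symm x) := by
      have hev' : ∀ᶠ z in 𝓝 ((chartAt H m₁).symm (I.symm (I y))), L₂ (π z) = g • z := by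
        rw [I.left_inv]
        exact hev
      exact hc.eventually hev'
    filter_upwards [nhdsWithin_le_nhds h4] with z hz
    simp [hL₁, hz]
  · simp [hL₁, ← hm, hev.self_of_nhds]

end MulAction

/-! ### Pseudoconvexity and Levi-flatness in complex manifolds -/

namespace SCV

open Set

section

variable {E : Type*} [NormedAddCommGroup E] [NormedSpace ℂ E]
  {H : Type*} [TopologicalSpace H] (I : ModelWithCorners ℂ E H)
  {X : Type*} [TopologicalSpace X] [ChartedSpace H X]

/-- A continuous function `u` on an open subset `W` of a complex manifold is plurisubharmonic if it
satisfies the sub-mean value inequality on every closed holomorphic disc in `W`. Here `f` is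
holomorphic on an open neighbourhood `N` of the closed unit disc. -/
def IsContinuousPlurisubharmonicOn (u : X → ℝ) (W : Set X) : Prop :=
  ContinuousOn u W ∧
    ∀ (f : ℂ → X) (N : Set ℂ), IsOpen N → Metric.closedBall 0 1 ⊆ N →
      MDifferentiableOn 𝓘(ℂ) I f N → MapsTo f (Metric.closedBall 0 1) W →
      u (f 0) ≤ Real.circleAverage (u ∘ f) 0 1

/-- The open set `W` has a continuous plurisubharmonic exhaustion function. -/
def HasPlurisubharmonicExhaustion (W : Set X) : Prop :=
  ∃ u : X → ℝ, IsContinuousPlurisubharmonicOn I u W ∧ ∀ c : ℝ, IsCompact {x ∈ W | u x ≤ c}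

/-- A pseudoconvex domain in a complex manifold `X`: a connected open set `D` such that every
boundary point has an open neighbourhood `U`, contained in a coordinate domain, for which `U ∩ D`
(regarded through the coordinates as an open set of `ℂⁿ`) is pseudoconvex, i.e. has a continuous
plurisubharmonic exhaustion function. -/
def IsPseudoconvexDomain (D : Set X) : Prop :=
  IsOpen D ∧ IsConnected D ∧
    ∀ p ∈ frontier D, ∃ U : Set X, IsOpen U ∧ p ∈ U ∧ (∃ e ∈ atlas H X, U ⊆ e.source) ∧
      HasPlurisubharmonicExhaustion I (U ∩ D)

end

/-- The Levi form `∑ ∂²ρ/∂zⱼ∂z̄ₖ wⱼ w̄ₖ` of a real function `ρ` at the point `a`, evaluated on the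
vector `w`, in terms of the real second derivative. -/
noncomputable def leviForm {E : Type*} [NormedAddCommGroup E] [NormedSpace ℂ E]
    (ρ : E → ℝ) (a w : E) : ℝ :=
  (fderiv ℝ (fderiv ℝ ρ) a w w +
    fderiv ℝ (fderiv ℝ ρ) a (Complex.I • w) (Complex.I • w)) / 4

/-- The open set `D` has real-analytic Levi-flat boundary: near every boundary point there are a
holomorphic chart and a real-analytic function `ρ` with nowhere vanishing differential on the
boundary such that `D = {ρ < 0}` and `∂D = {ρ = 0}` in the chart, and the Levi form of `ρ` vanishes
on the complex tangent vectors of `∂D`. -/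
def HasRealAnalyticLeviFlatBoundary {E : Type*} [NormedAddCommGroup E] [NormedSpace ℂ E]
    {H : Type*} [TopologicalSpace H] (I : ModelWithCorners ℂ E H)
    {X : Type*} [TopologicalSpace X] [ChartedSpace H X] (D : Set X) : Prop :=
  ∀ p ∈ frontier D, ∃ e ∈ IsManifold.maximalAtlas I ω X, p ∈ e.source ∧ ∃ ρ : E → ℝ,
    AnalyticOnNhd ℝ ρ (e.extend I).target ∧
    (∀ x ∈ e.source, x ∈ D ↔ ρ (e.extend I x) < 0) ∧
    (∀ x ∈ e.source, x ∈ frontier D ↔ ρ (e.extend I x) = 0) ∧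
    ∀ a ∈ (e.extend I).target, ρ a = 0 →
      fderiv ℝ ρ a ≠ 0 ∧
      ∀ w : E, fderiv ℝ ρ a w = 0 → fderiv ℝ ρ a (Complex.I • w) = 0 → leviForm ρ a w = 0

end SCV

/-! ### The flat bundle over the Hopf surface -/

namespace HopfBundle

open Topology

/-- The punctured plane `ℂ² ∖ {0}`. -/
def puncturedPlane : TopologicalSpace.Opens (EuclideanSpace ℂ (Fin 2)) :=
  ⟨{0}ᶜ, isOpen_compl_singleton⟩

theorem ne_zero (z : puncturedPlane) : (z : EuclideanSpace ℂ (Fin 2)) ≠ 0 := z.2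

/-- The matrix of the Möbius transformation `φ(v) = (v + 1/2) / (1 + v/2)`. -/
noncomputable def phi : GL (Fin 2) ℂ :=
  Matrix.GeneralLinearGroup.mkOfDetNeZero !![1, 1 / 2; 1 / 2, 1]
    (by rw [Matrix.det_fin_two_of]; norm_num)

/-- The action of `phi` on the Riemann sphere is the expected one. -/
theorem phi_smul_coe (v : ℂ) (hv : 1 + v / 2 ≠ 0) :
    phi • (v : OnePoint ℂ) = (((v + 1 / 2) / (1 + v / 2) : ℂ) : OnePoint ℂ) := by
  have h : (1 / 2 : ℂ) * v + 1 ≠ 0 := by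
    intro h; apply hv; rw [← h]; ring
  have e00 : phi 0 0 = 1 := rfl
  have e01 : phi 0 1 = 1 / 2 := rfl
  have e10 : phi 1 0 = 1 / 2 := rfl
  have e11 : phi 1 1 = 1 := rfl
  rw [OnePoint.smul_some_eq_ite, e00, e01, e10, e11, if_neg h]
  congr 2 <;> ring

/-- The infinite cyclic group `Γ = {γₙ ; n ∈ ℤ}`. -/
def Deck : Type := Multiplicative ℤ

instance : CommGroup Deck := inferInstanceAs (CommGroup (Multiplicative ℤ))

/-- The integer `n` belonging to `γₙ`. -/
def Deck.exponent (γ : Deck) : ℤ := Multiplicative.toAdd (α := ℤ) γ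

theorem Deck.exponent_one : Deck.exponent 1 = 0 := rfl

theorem Deck.exponent_mul (γ γ' : Deck) : (γ * γ').exponent = γ.exponent + γ'.exponent := rfl

theorem Deck.exponent_injective : Function.Injective Deck.exponent := fun _ _ h ↦ h

/-- The action of `Γ` on `ℂ² ∖ {0}`: `γₙ z = 2ⁿ z`. -/
noncomputable instance : MulAction Deck puncturedPlane where
  smul γ z := ⟨(2 : ℂ) ^ γ.exponent • (z : EuclideanSpace ℂ (Fin 2)),
    smul_ne_zero (zpow_ne_zero _ two_ne_zero) (ne_zero z)⟩
  one_smul z := Subtype.ext (by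
    change (2 : ℂ) ^ (0 : ℤ) • (z : EuclideanSpace ℂ (Fin 2)) = z
    simp)
  mul_smul γ γ' z := Subtype.ext (by
    change (2 : ℂ) ^ (γ.exponent + γ'.exponent) • (z : EuclideanSpace ℂ (Fin 2)) =
      (2 : ℂ) ^ γ.exponent • (2 : ℂ) ^ γ'.exponent • (z : EuclideanSpace ℂ (Fin 2))
    rw [zpow_add₀ two_ne_zero, mul_smul])

theorem coe_smul (γ : Deck) (z : puncturedPlane) :
    ((γ • z : puncturedPlane) : EuclideanSpace ℂ (Fin 2)) = (2 : ℂ) ^ γ.exponent • z.1 := rfl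

/-- The action of `Γ` on the Riemann sphere: `γₙ v = φⁿ(v)`. -/
noncomputable instance : MulAction Deck (OnePoint ℂ) where
  smul γ v := phi ^ γ.exponent • v
  one_smul v := by
    change phi ^ (0 : ℤ) • v = v
    simp
  mul_smul γ γ' v := by
    change phi ^ (γ.exponent + γ'.exponent) • v = phi ^ γ.exponent • phi ^ γ'.exponent • v
    rw [zpow_add, mul_smul]

theorem smul_sphere (γ : Deck) (v : OnePoint ℂ) : γ • v = phi ^ γ.exponent • v := rfl

/-- The trivial bundle `(ℂ² ∖ {0}) × ℙ¹`, with the diagonal action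
`γₙ (z, v) = (2ⁿ z, φⁿ(v))` of `Γ`. -/
abbrev Cover : Type := puncturedPlane × OnePoint ℂ

/-- The model with corners for the three-dimensional complex manifolds below. -/
noncomputable abbrev model : ModelWithCorners ℂ (EuclideanSpace ℂ (Fin 2) × ℂ)
    (ModelProd (EuclideanSpace ℂ (Fin 2)) ℂ) :=
  𝓘(ℂ, EuclideanSpace ℂ (Fin 2)).prod 𝓘(ℂ)

theorem contMDiff_smul_puncturedPlane (γ : Deck) :
    ContMDiff 𝓘(ℂ, EuclideanSpace ℂ (Fin 2)) 𝓘(ℂ, EuclideanSpace ℂ (Fin 2)) ω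
      (fun z : puncturedPlane ↦ γ • z) := by
  have h : ContMDiff 𝓘(ℂ, EuclideanSpace ℂ (Fin 2)) 𝓘(ℂ, EuclideanSpace ℂ (Fin 2)) ω
      (fun z : puncturedPlane ↦ (2 : ℂ) ^ γ.exponent • (z : EuclideanSpace ℂ (Fin 2))) :=
    (contDiff_const_smul ((2 : ℂ) ^ γ.exponent)).contMDiff.comp contMDiff_subtype_val
  intro z
  have h' := h z
  rw [contMDiffAt_iff] at h' ⊢
  refine ⟨?_, h'.2⟩
  rw [Topology.IsInducing.subtypeVal.continuousAt_iff]
  exact h'.1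

theorem contMDiff_smul (γ : Deck) :
    ContMDiff model model ω (fun x : Cover ↦ γ • x) :=
  ((contMDiff_smul_puncturedPlane γ).comp contMDiff_fst).prodMk
    ((RiemannSphere.contMDiff_smul (phi ^ γ.exponent)).comp contMDiff_snd)

instance : ContinuousConstSMul Deck Cover := ⟨fun γ ↦ (contMDiff_smul γ).continuous⟩

theorem log_norm_smul (γ : Deck) (z : puncturedPlane) :
    Real.log ‖(γ • z : puncturedPlane).1‖ = γ.exponent * Real.log 2 + Real.log ‖z.1‖ := by
  rw [coe_smul, norm_smul, norm_zpow, Complex.norm_ofNat,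
    Real.log_mul (zpow_ne_zero _ two_ne_zero) (norm_ne_zero_iff.mpr (ne_zero z)), Real.log_zpow]

instance : ProperlyDiscontinuousSMul Deck Cover where
  finite_disjoint_inter_image {K L} hK hL := by
    have hcont : Continuous (fun x : Cover ↦ Real.log ‖x.1.1‖) := by
      refine Continuous.log (by fun_prop) fun x ↦ norm_ne_zero_iff.mpr (ne_zero x.1)
    obtain ⟨a, ha⟩ := (hK.image hcont).isBounded.subset_closedBall 0
    obtain ⟨b, hb⟩ := (hL.image hcont).isBounded.subset_closedBall 0
    have hlog : 0 < Real.log 2 := Real.log_pos one_lt_two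
    refine Set.Finite.subset ((Set.finite_Icc (-⌈(a + b) / Real.log 2⌉)
      ⌈(a + b) / Real.log 2⌉).preimage Deck.exponent_injective.injOn) ?_
    rintro γ ⟨_, ⟨x, hx, rfl⟩, hxL⟩
    have h1 := ha ⟨x, hx, rfl⟩
    have h2 := hb ⟨_, hxL, rfl⟩
    simp only [Prod.smul_fst, log_norm_smul, mem_closedBall_zero_iff, Real.norm_eq_abs,
      abs_le] at h1 h2
    have h3 := Int.le_ceil ((a + b) / Real.log 2)
    rw [div_le_iff₀ hlog] at h3
    constructor
    · have : -(⌈(a + b) / Real.log 2⌉ : ℝ) ≤ (γ.exponent : ℝ) := by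
        by_contra! h
        nlinarith
      exact_mod_cast this
    · have : (γ.exponent : ℝ) ≤ (⌈(a + b) / Real.log 2⌉ : ℝ) := by
        by_contra! h
        nlinarith
      exact_mod_cast this

instance : IsCancelSMul Deck Cover := by
  rw [isCancelSMul_iff_eq_one_of_smul_eq]
  intro γ x hx
  have h := log_norm_smul γ x.1
  rw [← Prod.smul_fst, hx] at h
  have h' : (γ.exponent : ℝ) * Real.log 2 = 0 := by linarith
  have h2 : (γ.exponent : ℝ) = 0 :=
    (mul_eq_zero.mp h').resolve_right (Real.log_pos one_lt_two).ne'
  exact Deck.exponent_injective (by exact_mod_cast h2)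

instance : LocallyCompactSpace puncturedPlane :=
  have : ProperSpace (EuclideanSpace ℂ (Fin 2)) := FiniteDimensional.proper_rclike ℂ _
  puncturedPlane.isOpen.locallyCompactSpace

/-- The total space `B = ((ℂ² ∖ {0}) × ℙ¹) / Γ` of the flat `ℙ¹`-bundle over the Hopf surface
`(ℂ² ∖ {0}) / Γ`, with the quotient topology and the quotient complex structure. -/
noncomputable abbrev TotalSpace : Type := MulAction.orbitRel.Quotient Deck Cover

instance : IsManifold model ω TotalSpace := MulAction.isManifold_quotient model ω contMDiff_smul

/-- The point `[z, v]` of `B`. -/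
noncomputable def point (z : puncturedPlane) (v : OnePoint ℂ) : TotalSpace := Quotient.mk _ (z, v)

/-- The flat disc bundle `Ω = {[z, v] ; |v| < 1}` in `B`. -/
def discBundle : Set TotalSpace :=
  {b | ∃ (z : puncturedPlane) (v : ℂ), ‖v‖ < 1 ∧ b = point z v}

/-- The flat circle bundle `M = {[z, v] ; |v| = 1}` in `B`. -/
def circleBundle : Set TotalSpace :=
  {b | ∃ (z : puncturedPlane) (v : ℂ), ‖v‖ = 1 ∧ b = point z v}

end HopfBundle

/-! The heart of the matter is that `B` itself is the only pseudoconvex domain containing the closed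
disc bundle (`eq_univ_of_isPseudoconvexDomain`). The fixed points of `phi` are `1` and `-1`, both on
the unit circle. Sending them to `∞` and `0` by `cayley` gives a fibre coordinate `s` in which `phi`
is `s ↦ 3 s`, the disc is `Re s < 0` and its exterior is `Re s > 0`. Off the closed disc bundle `s`
is therefore finite and nonzero, and `height`, that is `(log 3 / log 2) log ‖z‖ - log ‖s‖`, is a
continuous `Γ`-invariant function there.

Suppose `D ≠ B` is pseudoconvex and contains the closed disc bundle. The complement of `D` is
compact, so `height` has a maximum on it, at some `[z₀, s₀]` (`exists_isMax_height`). Along the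
complex line through `z₀` orthogonal to `z₀`, `‖z‖` has a strict minimum at `z₀`, so `height`
strictly increases away from the centre; replacing `s₀` by `exp (-t) s₀` raises it by `t`. Hence
small discs in this line, pushed by `t ≥ 0`, lie in `D` except for the centre of the disc `t = 0`.
The Kontinuitätssatz (`HasPlurisubharmonicExhaustion.mem_of_family_of_discs`) puts that centre in
`D` as well, a contradiction.

Levi-flatness comes from the defining function `|v|² - 1`, which depends on the fibre coordinate
alone. -/

/-! ### The projection to a quotient manifold -/

namespace MulAction

open Topology

section

variable {M : Type*} [TopologicalSpace M] {G : Type*} [Group G] [MulAction G M]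
  [ProperlyDiscontinuousSMul G M] [ContinuousConstSMul G M] [IsCancelSMul G M]
  [T2Space M] [LocallyCompactSpace M] {H : Type*} [TopologicalSpace H] [ChartedSpace H M]

/-- The preferred charts of a quotient manifold are charts of the covering manifold, composed with
local sections of the projection. -/
theorem exists_chartAt_quotient (G : Type*) [Group G] [MulAction G M]
    [ProperlyDiscontinuousSMul G M] [ContinuousConstSMul G M] [IsCancelSMul G M]
    (H : Type*) [TopologicalSpace H] [ChartedSpace H M] (q : orbitRel.Quotient G M) :
    ∃ L : OpenPartialHomeomorph (orbitRel.Quotient G M) M,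
      (∀ x, L.symm x = (Quotient.mk _ x : orbitRel.Quotient G M)) ∧ q ∈ L.source ∧
      chartAt H q = L.trans (chartAt H (L q)) := by
  have hloc : IsLocalHomeomorph (Quotient.mk _ : M → orbitRel.Quotient G M) :=
    (isQuotientCoveringMap_quotientMk_of_properlyDiscontinuousSMul
      (G := G)).isCoveringMap.isLocalHomeomorph
  have hs : Function.Surjective (Quotient.mk _ : M → orbitRel.Quotient G M) :=
    Quotient.mk_surjective
  set m : M := hs.hasRightInverse.choose q
  have hm : (Quotient.mk _ m : orbitRel.Quotient G M) = q := hs.hasRightInverse.choose_spec q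
  have hLq : hloc.localInverseAt m q = m := by
    conv_lhs => rw [← hm]
    exact hloc.localInverseAt_apply_self
  refine ⟨hloc.localInverseAt m, fun x ↦ by rw [hloc.localInverseAt_symm], ?_, ?_⟩
  · rw [← hm]
    exact hloc.apply_self_mem_localInverseAt_source
  · rw [hLq]
    rfl

/-- If the group acts by `C^n` maps, then the projection to the quotient manifold is `C^n`. -/
theorem contMDiff_quotientMk {𝕜 : Type*} [NontriviallyNormedField 𝕜]
    {E : Type*} [NormedAddCommGroup E] [NormedSpace 𝕜 E]
    (I : ModelWithCorners 𝕜 E H) (n : ℕ∞ω) [IsManifold I n M]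
    (hG : ∀ g : G, ContMDiff I I n (fun x : M ↦ g • x)) :
    ContMDiff I I n (Quotient.mk _ : M → orbitRel.Quotient G M) := by
  intro m
  have hcov : IsQuotientCoveringMap (Quotient.mk _ : M → orbitRel.Quotient G M) G :=
    isQuotientCoveringMap_quotientMk_of_properlyDiscontinuousSMul
  have hcont := hcov.isCoveringMap.continuous
  set π : M → orbitRel.Quotient G M := Quotient.mk _ with hπ
  obtain ⟨L, hL, hq, hchart⟩ := exists_chartAt_quotient G H (π m)
  rw [contMDiffAt_iff_target]
  refine ⟨hcont.continuousAt, ?_⟩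
  have hπm : π (L (π m)) = π m := by
    have h := L.left_inv hq
    rwa [hL] at h
  -- The local section `L` need not return `m`, only a point of its orbit; near `m`, the map `L ∘ π`
  -- is then the action of one fixed `g`.
  obtain ⟨g, hg⟩ := hcov.apply_eq_iff_mem_orbit.mp hπm
  simp only at hg
  have hev : ∀ᶠ z in 𝓝 m, L (π z) = g • z := by
    have h1 : ∀ᶠ z in 𝓝 m, g • z ∈ L.target := by
      refine (continuous_const_smul g).continuousAt.eventually (L.open_target.mem_nhds ?_)
      change g • m ∈ L.target
      rw [hg]
      exact L.map_source hq
    filter_upwards [h1] with z hz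
    have : π z = L.symm (g • z) := by rw [hL, ← hπ, hcov.map_smul]
    rw [this, L.right_inv hz]
  have h1 : ContMDiffAt I 𝓘(𝕜, E) n (extChartAt I (L (π m))) (g • m) :=
    contMDiffAt_extChartAt' (by rw [hg]; exact mem_chart_source _ _)
  refine (h1.comp m (hG g m)).congr_of_eventuallyEq ?_
  filter_upwards [hev] with z hz
  simp [extChartAt, hchart, hz]

end

end MulAction

/-! ### The Kontinuitätssatz -/

namespace SCV

open Set Topology Filter

/-- If a set has a continuous plurisubharmonic exhaustion function, then a continuous family of
closed holomorphic discs whose members lie in the set, except possibly for the centre of the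
limit disc, has all of its centres in the set. -/
theorem HasPlurisubharmonicExhaustion.mem_of_family_of_discs
    {E : Type*} [NormedAddCommGroup E] [NormedSpace ℂ E]
    {H : Type*} [TopologicalSpace H] {I : ModelWithCorners ℂ E H}
    {X : Type*} [TopologicalSpace X] [T2Space X] [ChartedSpace H X] {W : Set X}
    (hW : HasPlurisubharmonicExhaustion I W) (F : ℝ → ℂ → X) {t₀ : ℝ} (ht₀ : 0 < t₀)
    (hF : Continuous (fun p : ℝ × ℂ ↦ F p.1 p.2))
    (hFd : ∀ t, MDifferentiable 𝓘(ℂ) I (F t))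
    (hFW : ∀ t ∈ Icc 0 t₀, ∀ ζ ∈ Metric.closedBall (0 : ℂ) 1, 0 < t ∨ ζ ≠ 0 → F t ζ ∈ W) :
    F 0 0 ∈ W := by
  obtain ⟨u, ⟨huc, hu⟩, hcomp⟩ := hW
  have hS : IsCompact ((fun p : ℝ × ℂ ↦ F p.1 p.2) '' (Icc 0 t₀ ×ˢ Metric.sphere (0 : ℂ) 1)) :=
    (isCompact_Icc.prod (isCompact_sphere _ _)).image hF
  have hsph : ∀ ζ ∈ Metric.sphere (0 : ℂ) 1, ζ ≠ 0 := by
    rintro ζ hζ rfl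
    simp at hζ
  have hSW : (fun p : ℝ × ℂ ↦ F p.1 p.2) '' (Icc 0 t₀ ×ˢ Metric.sphere (0 : ℂ) 1) ⊆ W := by
    rintro _ ⟨⟨t, ζ⟩, ⟨ht, hζ⟩, rfl⟩
    exact hFW t ht ζ (Metric.sphere_subset_closedBall hζ) (Or.inr (hsph ζ hζ))
  -- The boundary circles avoid the exceptional centre, so together they form a compact subset of
  -- `W`. The mean value inequality carries the bound `C` to the centres with `t > 0`.
  obtain ⟨C, hC⟩ := hS.bddAbove_image (huc.mono hSW)
  have hle : ∀ t ∈ Ioc 0 t₀, F t 0 ∈ {x ∈ W | u x ≤ C} := by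
    intro t ht
    have ht' : t ∈ Icc 0 t₀ := ⟨ht.1.le, ht.2⟩
    have hFt : Continuous (F t) := hF.comp (Continuous.prodMk_right t)
    refine ⟨hFW t ht' 0 (by simp) (Or.inl ht.1), ?_⟩
    have hmaps : MapsTo (F t) (Metric.closedBall 0 1) W := fun ζ hζ ↦ hFW t ht' ζ hζ (Or.inl ht.1)
    refine (hu (F t) univ isOpen_univ (subset_univ _) (hFd t).mdifferentiableOn hmaps).trans ?_
    refine Real.circleAverage_mono_on_of_le_circle ?_ ?_
    · refine ContinuousOn.circleIntegrable zero_le_one ?_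
      exact huc.comp hFt.continuousOn (hmaps.mono_left Metric.sphere_subset_closedBall)
    · intro ζ hζ
      rw [abs_one] at hζ
      exact hC ⟨_, ⟨(t, ζ), ⟨ht', hζ⟩, rfl⟩, rfl⟩
  have hlim : Tendsto (fun t ↦ F t 0) (𝓝[>] 0) (𝓝 (F 0 0)) :=
    ((hF.comp (Continuous.prodMk_left (0 : ℂ))).tendsto 0).mono_left nhdsWithin_le_nhds
  -- The sublevel set is compact, hence closed in `X` and not merely in `W`, so the limit centre
  -- cannot leave `W`.
  refine ((hcomp C).isClosed.mem_of_tendsto hlim ?_).1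
  filter_upwards [Ioc_mem_nhdsGT ht₀] with t ht using hle t ht

/-! ### Quadratic defining functions -/

/-- The function `ℓ₁² + ℓ₂² - 1`, for two continuous real linear forms, is real-analytic. -/
theorem analyticOnNhd_sq_add_sq_sub_one {E : Type*} [NormedAddCommGroup E] [NormedSpace ℝ E]
    (l₁ l₂ : E →L[ℝ] ℝ) (s : Set E) : AnalyticOnNhd ℝ (fun a ↦ l₁ a ^ 2 + l₂ a ^ 2 - 1) s :=
  fun a _ ↦ (((l₁.analyticAt a).pow 2).add ((l₂.analyticAt a).pow 2)).sub analyticAt_const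

/-- Writing the derivative as a continuous linear map of the base point makes the second derivative,
needed for the Levi form, that same map. -/
theorem fderiv_sq_add_sq_sub_one {E : Type*} [NormedAddCommGroup E] [NormedSpace ℝ E]
    (l₁ l₂ : E →L[ℝ] ℝ) :
    fderiv ℝ (fun a ↦ l₁ a ^ 2 + l₂ a ^ 2 - 1) =
      ((2 : ℝ) • (l₁.smulRight l₁ + l₂.smulRight l₂) : E →L[ℝ] E →L[ℝ] ℝ) := by
  ext a w
  have h : HasFDerivAt (fun a ↦ l₁ a ^ 2 + l₂ a ^ 2 - 1) _ a :=
    (((l₁.hasFDerivAt (x := a)).pow 2).add ((l₂.hasFDerivAt (x := a)).pow 2)).sub_const 1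
  rw [h.fderiv]
  simp
  ring

end SCV

namespace HopfBundle

open Topology Set

/-! ### The fibre coordinate that linearizes the monodromy -/

/-- The matrix of the involution `s ↦ (s + 1) / (s - 1)`, which maps the left half plane to the unit
disc and conjugates `phi` to `s ↦ 3 s`. -/
noncomputable def cayley : GL (Fin 2) ℂ :=
  Matrix.GeneralLinearGroup.mkOfDetNeZero !![1, 1; 1, -1]
    (by rw [Matrix.det_fin_two_of]; norm_num)

theorem cayley_smul_one : cayley • ((1 : ℂ) : OnePoint ℂ) = OnePoint.infty := by
  have e10 : cayley 1 0 = 1 := rfl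
  have e11 : cayley 1 1 = -1 := rfl
  simp [OnePoint.smul_some_eq_ite, e10, e11]

theorem cayley_smul_coe {s : ℂ} (hs : s ≠ 1) :
    cayley • (s : OnePoint ℂ) = (((s + 1) / (s - 1) : ℂ) : OnePoint ℂ) := by
  have e00 : cayley 0 0 = 1 := rfl
  have e01 : cayley 0 1 = 1 := rfl
  have e10 : cayley 1 0 = 1 := rfl
  have e11 : cayley 1 1 = -1 := rfl
  have h : s + -1 ≠ 0 := by rwa [← sub_eq_add_neg, sub_ne_zero]
  simp [OnePoint.smul_some_eq_ite, e00, e01, e10, e11, h, sub_eq_add_neg]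

theorem cayley_smul_infty : cayley • (OnePoint.infty : OnePoint ℂ) = ((1 : ℂ) : OnePoint ℂ) := by
  have e00 : cayley 0 0 = 1 := rfl
  have e10 : cayley 1 0 = 1 := rfl
  simp [OnePoint.smul_infty_eq_ite, e00, e10]

theorem cayley_smul_cayley_smul (x : OnePoint ℂ) : cayley • cayley • x = x := by
  induction x using OnePoint.rec with
  | infty => rw [cayley_smul_infty, cayley_smul_one]
  | coe s =>
    by_cases hs : s = 1
    · rw [hs, cayley_smul_one, cayley_smul_infty]
    · have h1 : s - 1 ≠ 0 := sub_ne_zero.mpr hs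
      have h2 : (s + 1) / (s - 1) ≠ 1 := by
        rw [Ne, div_eq_one_iff_eq h1]
        intro h
        have : (2 : ℂ) = 0 := by linear_combination h
        norm_num at this
      rw [cayley_smul_coe hs, cayley_smul_coe h2]
      congr 1
      have h3 : (s + 1) / (s - 1) - 1 ≠ 0 := sub_ne_zero.mpr h2
      rw [div_eq_iff h3]
      field_simp
      ring

/-- The columns `(1, 1)` and `(1, -1)` of `cayley` are eigenvectors of `phi`, with eigenvalues `3/2`
and `1/2`; the multiplier `3` is their ratio. -/
theorem phi_smul_cayley_smul (s : ℂ) :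
    phi • cayley • (s : OnePoint ℂ) = cayley • ((3 * s : ℂ) : OnePoint ℂ) := by
  have p00 : phi 0 0 = 1 := rfl
  have p01 : phi 0 1 = 1 / 2 := rfl
  have p10 : phi 1 0 = 1 / 2 := rfl
  have p11 : phi 1 1 = 1 := rfl
  have e00 : cayley 0 0 = 1 := rfl
  have e01 : cayley 0 1 = 1 := rfl
  have e10 : cayley 1 0 = 1 := rfl
  have e11 : cayley 1 1 = -1 := rfl
  have m : ∀ i j, (phi * cayley) i j = phi i 0 * cayley 0 j + phi i 1 * cayley 1 j := by
    intro i j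
    rw [Matrix.GeneralLinearGroup.coe_mul, Matrix.mul_apply, Fin.sum_univ_two]
  rw [← mul_smul, OnePoint.smul_some_eq_ite, OnePoint.smul_some_eq_ite, m, m, m, m, p00, p01, p10,
    p11, e00, e01, e10, e11]
  have h : (1 / 2 * 1 + 1 * 1) * s + (1 / 2 * 1 + 1 * -1) = (1 / 2 : ℂ) * (1 * (3 * s) + -1) := by
    ring
  have h' : (1 * 1 + 1 / 2 * 1) * s + (1 * 1 + 1 / 2 * -1) = (1 / 2 : ℂ) * (1 * (3 * s) + 1) := by
    ring
  rw [h, h', mul_div_mul_left _ _ (by norm_num : (1 / 2 : ℂ) ≠ 0)]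
  simp

theorem smul_cayley_smul (γ : Deck) (s : ℂ) :
    γ • cayley • (s : OnePoint ℂ) = cayley • (((3 : ℂ) ^ γ.exponent * s : ℂ) : OnePoint ℂ) := by
  rw [smul_sphere]
  generalize γ.exponent = n
  have hinv : ∀ s : ℂ, phi⁻¹ • cayley • (s : OnePoint ℂ) =
      cayley • (((3 : ℂ)⁻¹ * s : ℂ) : OnePoint ℂ) := by
    intro s
    rw [inv_smul_eq_iff, phi_smul_cayley_smul, mul_inv_cancel_left₀ three_ne_zero]
  induction n using Int.induction_on with
  | zero => simp
  | succ n ih =>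
    rw [add_comm, zpow_add, zpow_one, mul_smul, ih, phi_smul_cayley_smul, zpow_add₀ three_ne_zero,
      zpow_one, mul_assoc]
  | pred n ih =>
    rw [sub_eq_add_neg, add_comm, zpow_add, zpow_neg_one, mul_smul, ih, hinv,
      zpow_add₀ three_ne_zero, zpow_neg_one, mul_assoc]

/-- The sign of `s.re` decides whether `(s + 1) / (s - 1)` lies inside or outside the unit circle.
-/
theorem sq_norm_cayley (s : ℂ) : ‖s + 1‖ ^ 2 = ‖s - 1‖ ^ 2 + 4 * s.re := by
  rw [← Complex.normSq_eq_norm_sq, ← Complex.normSq_eq_norm_sq, Complex.normSq_apply,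
    Complex.normSq_apply]
  simp
  ring

/-! ### The disc and its exterior as half planes -/

/-- The unit disc in the Riemann sphere. -/
def unitDisc : Set (OnePoint ℂ) := (↑) '' Metric.ball (0 : ℂ) 1

/-- The closed unit disc in the Riemann sphere. -/
def closedUnitDisc : Set (OnePoint ℂ) := (↑) '' Metric.closedBall (0 : ℂ) 1

theorem coe_mem_unitDisc {v : ℂ} : (v : OnePoint ℂ) ∈ unitDisc ↔ ‖v‖ < 1 := by
  simp [unitDisc]

theorem coe_mem_closedUnitDisc {v : ℂ} : (v : OnePoint ℂ) ∈ closedUnitDisc ↔ ‖v‖ ≤ 1 := by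
  simp [closedUnitDisc]

theorem infty_notMem_closedUnitDisc : OnePoint.infty ∉ closedUnitDisc := by
  simp [closedUnitDisc]

theorem unitDisc_subset_closedUnitDisc : unitDisc ⊆ closedUnitDisc :=
  image_mono Metric.ball_subset_closedBall

theorem isOpen_unitDisc : IsOpen unitDisc :=
  OnePoint.isOpenEmbedding_coe.isOpenMap _ Metric.isOpen_ball

theorem closure_unitDisc : closure unitDisc = closedUnitDisc := by
  apply Subset.antisymm
  · exact closure_minimal unitDisc_subset_closedUnitDisc
      ((isCompact_closedBall 0 1).image OnePoint.continuous_coe).isClosed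
  · rw [closedUnitDisc, ← closure_ball (0 : ℂ) one_ne_zero]
    exact image_closure_subset_closure_image OnePoint.continuous_coe

theorem mem_unitDisc_iff_cayley {x : OnePoint ℂ} :
    x ∈ unitDisc ↔ ∃ s : ℂ, s.re < 0 ∧ x = cayley • (s : OnePoint ℂ) := by
  constructor
  · rintro ⟨v, hv, rfl⟩
    rw [mem_ball_zero_iff] at hv
    have hv1 : v ≠ 1 := by
      rintro rfl
      simp at hv
    have h1 : v - 1 ≠ 0 := sub_ne_zero.mpr hv1
    refine ⟨(v + 1) / (v - 1), ?_, ?_⟩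
    · have h2 := sq_norm_cayley ((v + 1) / (v - 1))
      have e1 : (v + 1) / (v - 1) + 1 = 2 * v / (v - 1) := by field_simp; ring
      have e2 : (v + 1) / (v - 1) - 1 = 2 / (v - 1) := by field_simp; ring
      have h3 : 0 < ‖v - 1‖ := norm_pos_iff.mpr h1
      rw [e1, e2, norm_div, norm_div, norm_mul, Complex.norm_ofNat, div_pow, div_pow] at h2
      have h4 : (2 * ‖v‖) ^ 2 / ‖v - 1‖ ^ 2 < 2 ^ 2 / ‖v - 1‖ ^ 2 := by
        gcongr
        nlinarith [norm_nonneg v]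
      linarith
    · rw [← cayley_smul_coe hv1, cayley_smul_cayley_smul]
  · rintro ⟨s, hs, rfl⟩
    have hs1 : s ≠ 1 := by
      rintro rfl
      norm_num at hs
    have h3 : 0 < ‖s - 1‖ := norm_pos_iff.mpr (sub_ne_zero.mpr hs1)
    rw [cayley_smul_coe hs1, coe_mem_unitDisc, norm_div, div_lt_one h3]
    have := sq_norm_cayley s
    exact lt_of_pow_lt_pow_left₀ 2 h3.le (by linarith)

/-- The whole exterior, with `∞` at `s = 1`, lies in the finite `s`-plane away from `0`, because `s
= ∞` and `s = 0` are the circle points `1` and `-1`. -/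
theorem notMem_closedUnitDisc_iff_cayley {x : OnePoint ℂ} :
    x ∉ closedUnitDisc ↔ ∃ s : ℂ, 0 < s.re ∧ x = cayley • (s : OnePoint ℂ) := by
  constructor
  · intro hx
    induction x using OnePoint.rec with
    | infty => exact ⟨1, by simp, cayley_smul_one.symm⟩
    | coe v =>
      rw [coe_mem_closedUnitDisc, not_le] at hx
      have hv1 : v ≠ 1 := by
        rintro rfl
        simp at hx
      have h1 : v - 1 ≠ 0 := sub_ne_zero.mpr hv1
      refine ⟨(v + 1) / (v - 1), ?_, ?_⟩
      · have h2 := sq_norm_cayley ((v + 1) / (v - 1))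
        have e1 : (v + 1) / (v - 1) + 1 = 2 * v / (v - 1) := by field_simp; ring
        have e2 : (v + 1) / (v - 1) - 1 = 2 / (v - 1) := by field_simp; ring
        have h3 : 0 < ‖v - 1‖ := norm_pos_iff.mpr h1
        rw [e1, e2, norm_div, norm_div, norm_mul, Complex.norm_ofNat, div_pow, div_pow] at h2
        have h4 : 2 ^ 2 / ‖v - 1‖ ^ 2 < (2 * ‖v‖) ^ 2 / ‖v - 1‖ ^ 2 := by
          gcongr
          linarith
        linarith
      · rw [← cayley_smul_coe hv1, cayley_smul_cayley_smul]
  · rintro ⟨s, hs, rfl⟩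
    by_cases hs1 : s = 1
    · rw [hs1, cayley_smul_one]
      exact infty_notMem_closedUnitDisc
    · have h3 : 0 < ‖s - 1‖ := norm_pos_iff.mpr (sub_ne_zero.mpr hs1)
      rw [cayley_smul_coe hs1, coe_mem_closedUnitDisc, norm_div, not_le, one_lt_div h3]
      have := sq_norm_cayley s
      exact lt_of_pow_lt_pow_left₀ 2 (norm_nonneg _) (by linarith)

theorem re_three_zpow_mul (n : ℤ) (s : ℂ) : ((3 : ℂ) ^ n * s).re = (3 : ℝ) ^ n * s.re := by
  have : (3 : ℂ) ^ n = (((3 : ℝ) ^ n : ℝ) : ℂ) := by push_cast; rfl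
  rw [this, Complex.re_ofReal_mul]

/-- In the coordinate `s` the action multiplies by a positive real number, which preserves the half
plane. -/
theorem smul_mem_unitDisc {γ : Deck} {v : OnePoint ℂ} (hv : v ∈ unitDisc) : γ • v ∈ unitDisc := by
  rw [mem_unitDisc_iff_cayley] at hv ⊢
  obtain ⟨s, hs, rfl⟩ := hv
  exact ⟨_, by rw [re_three_zpow_mul]; exact mul_neg_of_pos_of_neg (by positivity) hs,
    smul_cayley_smul γ s⟩

/-! ### The disc bundle and its boundary -/

theorem point_smul (γ : Deck) (z : puncturedPlane) (v : OnePoint ℂ) :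
    point (γ • z) (γ • v) = point z v :=
  Quotient.sound ⟨γ, rfl⟩

theorem isOpenQuotientMap_mk :
    IsOpenQuotientMap (Quotient.mk _ : Cover → TotalSpace) :=
  MulAction.isOpenQuotientMap_quotientMk

theorem exists_point_eq (b : TotalSpace) : ∃ z v, point z v = b := by
  obtain ⟨⟨z, v⟩, h⟩ := isOpenQuotientMap_mk.surjective b
  exact ⟨z, v, h⟩

theorem preimage_discBundle :
    (Quotient.mk _ : Cover → TotalSpace) ⁻¹' discBundle = univ ×ˢ unitDisc := by
  ext ⟨z, v⟩
  constructor
  · rintro ⟨z', v', hv', h⟩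
    obtain ⟨γ, hγ⟩ : (z, v) ∈ MulAction.orbit Deck (z', (v' : OnePoint ℂ)) := Quotient.exact h
    have h2 : γ • (v' : OnePoint ℂ) = v := congrArg Prod.snd hγ
    exact ⟨trivial, h2 ▸ smul_mem_unitDisc (coe_mem_unitDisc.mpr hv')⟩
  · rintro ⟨-, v, hv, rfl⟩
    exact ⟨z, v, mem_ball_zero_iff.mp hv, rfl⟩

theorem isOpen_discBundle : IsOpen discBundle := by
  rw [← isOpenQuotientMap_mk.isQuotientMap.isOpen_preimage, preimage_discBundle]
  exact isOpen_univ.prod isOpen_unitDisc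

theorem isConnected_discBundle : IsConnected discBundle := by
  have h1 : IsConnected (univ : Set puncturedPlane) := by
    have : ConnectedSpace puncturedPlane := by
      -- A real vector space of dimension greater than one stays connected when a point is removed.
      refine isConnected_iff_connectedSpace.mp (isConnected_compl_singleton_of_one_lt_rank ?_ 0)
      rw [← Module.finrank_eq_rank]
      have h : Module.finrank ℝ (EuclideanSpace ℂ (Fin 2)) = 4 := by
        rw [finrank_real_of_complex, finrank_euclideanSpace_fin]
      rw [h]
      norm_num
    exact isConnected_univ
  rw [← image_preimage_eq discBundle isOpenQuotientMap_mk.surjective, preimage_discBundle]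
  refine (h1.prod ?_).image _ isOpenQuotientMap_mk.continuous.continuousOn
  exact ((convex_ball (0 : ℂ) 1).isConnected ⟨0, by simp⟩).image _
    OnePoint.continuous_coe.continuousOn

theorem preimage_closure_discBundle :
    (Quotient.mk _ : Cover → TotalSpace) ⁻¹' closure discBundle = univ ×ˢ closedUnitDisc := by
  rw [isOpenQuotientMap_mk.isOpenMap.preimage_closure_eq_closure_preimage
    isOpenQuotientMap_mk.continuous, preimage_discBundle, closure_prod_eq, closure_univ,
    closure_unitDisc]

theorem point_mem_closure_discBundle {z : puncturedPlane} {v : OnePoint ℂ} :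
    point z v ∈ closure discBundle ↔ v ∈ closedUnitDisc := by
  have h := Set.ext_iff.mp preimage_closure_discBundle (z, v)
  exact h.trans (by simp)

theorem point_mem_discBundle {z : puncturedPlane} {v : OnePoint ℂ} :
    point z v ∈ discBundle ↔ v ∈ unitDisc := by
  have h := Set.ext_iff.mp preimage_discBundle (z, v)
  exact h.trans (by simp)

theorem point_mem_frontier_discBundle {z : puncturedPlane} {v : OnePoint ℂ} :
    point z v ∈ frontier discBundle ↔ ∃ c : ℂ, ‖c‖ = 1 ∧ v = c := by
  rw [isOpen_discBundle.frontier_eq, mem_sdiff, point_mem_closure_discBundle, point_mem_discBundle]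
  constructor
  · rintro ⟨⟨c, hc, rfl⟩, h⟩
    rw [coe_mem_unitDisc, not_lt] at h
    exact ⟨c, le_antisymm (mem_closedBall_zero_iff.mp hc) h, rfl⟩
  · rintro ⟨c, hc, rfl⟩
    exact ⟨coe_mem_closedUnitDisc.mpr hc.le, fun h ↦ (coe_mem_unitDisc.mp h).ne hc⟩

theorem frontier_discBundle : frontier discBundle = circleBundle := by
  ext b
  constructor
  · intro hb
    obtain ⟨z, v, rfl⟩ := exists_point_eq b
    obtain ⟨c, hc, rfl⟩ := point_mem_frontier_discBundle.mp hb
    exact ⟨z, c, hc, rfl⟩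
  · rintro ⟨z, c, hc, rfl⟩
    exact point_mem_frontier_discBundle.mpr ⟨c, hc, rfl⟩

/-! ### Levi-flatness of the boundary -/

/-- The real part of the second component. -/
noncomputable def reSnd : EuclideanSpace ℂ (Fin 2) × ℂ →L[ℝ] ℝ :=
  Complex.reCLM.comp (ContinuousLinearMap.snd ℝ _ _)

/-- The imaginary part of the second component. -/
noncomputable def imSnd : EuclideanSpace ℂ (Fin 2) × ℂ →L[ℝ] ℝ :=
  Complex.imCLM.comp (ContinuousLinearMap.snd ℝ _ _)

theorem reSnd_apply (a : EuclideanSpace ℂ (Fin 2) × ℂ) : reSnd a = a.2.re := rfl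

theorem imSnd_apply (a : EuclideanSpace ℂ (Fin 2) × ℂ) : imSnd a = a.2.im := rfl

theorem hasRealAnalyticLeviFlatBoundary_discBundle :
    SCV.HasRealAnalyticLeviFlatBoundary model discBundle := by
  intro p hp
  obtain ⟨L, hL, hpL, hchart⟩ :=
    MulAction.exists_chartAt_quotient Deck (ModelProd (EuclideanSpace ℂ (Fin 2)) ℂ) p
  have hpt : ∀ x ∈ L.source, point (L x).1 (L x).2 = x := fun x hx ↦ by
    have h := L.left_inv hx
    rwa [hL] at h
  obtain ⟨c, -, hc⟩ : ∃ c : ℂ, ‖c‖ = 1 ∧ (L p).2 = c := by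
    rw [← hpt p hpL] at hp
    exact point_mem_frontier_discBundle.mp hp
  set e := chartAt (ModelProd (EuclideanSpace ℂ (Fin 2)) ℂ) p with he
  -- As `p` lies on the boundary, its fibre component is finite, so the chart at `p` uses the affine
  -- coordinate `v` throughout its source.
  have hsnd : ∀ x ∈ e.source, x ∈ L.source ∧ (L x).2 = ((e.extend model x).2 : ℂ) := by
    intro x hx
    rw [hchart] at hx ⊢
    refine ⟨hx.1, ?_⟩
    have h2 : (L x).2 ∈ RiemannSphere.finChart.source := by
      have h3 : (L x).2 ∈ (chartAt ℂ (L p).2).source := hx.2.2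
      rwa [hc] at h3
    have h4 :
        ((L.trans (chartAt (ModelProd (EuclideanSpace ℂ (Fin 2)) ℂ) (L p))).extend model x).2 =
        RiemannSphere.finChart (L x).2 := by
      change chartAt ℂ (L p).2 (L x).2 = _
      rw [hc]
      rfl
    rw [h4, ← RiemannSphere.finChart_symm, RiemannSphere.finChart.left_inv h2]
  have hnorm : ∀ v : ℂ, v.re ^ 2 + v.im ^ 2 - 1 = ‖v‖ ^ 2 - 1 := fun v ↦ by
    rw [← Complex.normSq_eq_norm_sq, Complex.normSq_apply]
    ring
  refine ⟨e, IsManifold.chart_mem_maximalAtlas p, mem_chart_source _ p,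
    fun a ↦ reSnd a ^ 2 + imSnd a ^ 2 - 1, SCV.analyticOnNhd_sq_add_sq_sub_one _ _ _, ?_, ?_, ?_⟩
  · intro x hx
    obtain ⟨hxL, hx2⟩ := hsnd x hx
    conv_lhs => rw [← hpt x hxL]
    beta_reduce
    rw [point_mem_discBundle, hx2, coe_mem_unitDisc, reSnd_apply, imSnd_apply, hnorm, sub_neg,
      sq_lt_one_iff₀ (norm_nonneg _)]
  · intro x hx
    obtain ⟨hxL, hx2⟩ := hsnd x hx
    conv_lhs => rw [← hpt x hxL]
    beta_reduce
    rw [point_mem_frontier_discBundle, hx2, reSnd_apply, imSnd_apply, hnorm, sub_eq_zero,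
      pow_eq_one_iff_of_nonneg (norm_nonneg _) two_ne_zero]
    simp
  · intro a _ ha
    beta_reduce at ha
    rw [reSnd_apply, imSnd_apply, sub_eq_zero] at ha
    have hd : ∀ w : EuclideanSpace ℂ (Fin 2) × ℂ,
        fderiv ℝ (fun a ↦ reSnd a ^ 2 + imSnd a ^ 2 - 1) a w =
          2 * (a.2.re * w.2.re + a.2.im * w.2.im) := by
      intro w
      rw [SCV.fderiv_sq_add_sq_sub_one]
      simp [reSnd_apply, imSnd_apply]
      ring
    constructor
    · intro h0
      -- Evaluated on the vector `a` itself, the differential is `2 |v|² = 2`.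
      have h1 := hd a
      rw [h0, zero_apply] at h1
      linarith
    · intro w hw hIw
      rw [hd] at hw hIw
      simp only [Prod.smul_snd, smul_eq_mul, Complex.I_mul_re, Complex.I_mul_im] at hIw
      -- The two tangency conditions are a real linear system for `w.2` with determinant a nonzero
      -- multiple of `|v|² = 1`. Complex tangent vectors thus have no fibre component, and the Levi
      -- form sees nothing else.
      have h1 : w.2.re = 0 := by
        linear_combination (a.2.re / 2) * hw + (a.2.im / 2) * hIw - w.2.re * ha
      have h2 : w.2.im = 0 := by
        linear_combination (a.2.im / 2) * hw - (a.2.re / 2) * hIw - w.2.im * ha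
      rw [SCV.leviForm, SCV.fderiv_sq_add_sq_sub_one, ContinuousLinearMap.fderiv]
      simp [reSnd_apply, imSnd_apply, h1, h2]

end HopfBundle

namespace HopfBundle

open Topology Set

/-! ### Pseudoconvex neighbourhoods of the closed disc bundle -/

theorem continuous_point : Continuous (fun x : puncturedPlane × OnePoint ℂ ↦ point x.1 x.2) :=
  isOpenQuotientMap_mk.continuous

/-! ### Complex lines orthogonal to the radial direction -/

/-- A vector of the same length as `z` that is orthogonal to `z`. -/
noncomputable def perp (z : EuclideanSpace ℂ (Fin 2)) : EuclideanSpace ℂ (Fin 2) :=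
  !₂[-(starRingEnd ℂ) (z 1), (starRingEnd ℂ) (z 0)]

theorem sq_norm_add_smul_perp (z : EuclideanSpace ℂ (Fin 2)) (ζ : ℂ) :
    ‖z + ζ • perp z‖ ^ 2 = (1 + ‖ζ‖ ^ 2) * ‖z‖ ^ 2 := by
  simp only [EuclideanSpace.norm_sq_eq, Fin.sum_univ_two, ← Complex.normSq_eq_norm_sq,
    Complex.normSq_apply, perp]
  simp
  ring

theorem add_smul_perp_ne_zero (z : puncturedPlane) (ζ : ℂ) : z.1 + ζ • perp z.1 ≠ 0 := by
  have hz : 0 < ‖z.1‖ := norm_pos_iff.mpr (ne_zero z)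
  intro h
  have h2 := sq_norm_add_smul_perp z.1 ζ
  rw [h, norm_zero] at h2
  have : 0 < (1 + ‖ζ‖ ^ 2) * ‖z.1‖ ^ 2 := by positivity
  linarith

/-- The complex line through `z` that is orthogonal to `z`. -/
noncomputable def normalLine (z : puncturedPlane) (ζ : ℂ) : puncturedPlane :=
  ⟨z.1 + ζ • perp z.1, add_smul_perp_ne_zero z ζ⟩

theorem normalLine_zero (z : puncturedPlane) : normalLine z 0 = z :=
  Subtype.ext (by simp [normalLine])

theorem log_norm_normalLine (z : puncturedPlane) (ζ : ℂ) :
    Real.log ‖(normalLine z ζ).1‖ = Real.log (1 + ‖ζ‖ ^ 2) / 2 + Real.log ‖z.1‖ := by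
  have hz : ‖z.1‖ ≠ 0 := norm_ne_zero_iff.mpr (ne_zero z)
  have h := congrArg Real.log (sq_norm_add_smul_perp z.1 ζ)
  rw [Real.log_mul (by positivity) (pow_ne_zero 2 hz), Real.log_pow, Real.log_pow] at h
  push_cast at h
  change Real.log ‖z.1 + ζ • perp z.1‖ = _
  linarith

theorem contMDiff_normalLine (z : puncturedPlane) :
    ContMDiff 𝓘(ℂ) 𝓘(ℂ, EuclideanSpace ℂ (Fin 2)) ω (normalLine z) := by
  have h : ContMDiff 𝓘(ℂ) 𝓘(ℂ, EuclideanSpace ℂ (Fin 2)) ω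
      (fun ζ : ℂ ↦ z.1 + ζ • perp z.1) :=
    (contDiff_const.add (contDiff_id.smul contDiff_const)).contMDiff
  intro ζ
  have h' := h ζ
  rw [contMDiffAt_iff] at h' ⊢
  refine ⟨?_, h'.2⟩
  rw [Topology.IsInducing.subtypeVal.continuousAt_iff]
  exact h'.1

/-! ### The invariant height function and its maximum -/

/-- A function on the cover, in the fibre coordinate `s`, that is invariant under `Γ`,
plurisubharmonic, and strictly so along the complex lines orthogonal to the radial direction. -/
noncomputable def height (z : puncturedPlane) (s : ℂ) : ℝ :=
  Real.log 3 / Real.log 2 * Real.log ‖z.1‖ - Real.log ‖s‖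

/-- The factor `log 3 / log 2` balances the scalings `2ⁿ` of `z` and `3ⁿ` of `s`. -/
theorem height_smul (γ : Deck) (z : puncturedPlane) {s : ℂ} (hs : s ≠ 0) :
    height (γ • z) ((3 : ℂ) ^ γ.exponent * s) = height z s := by
  have h2 : Real.log 2 ≠ 0 := (Real.log_pos one_lt_two).ne'
  rw [height, height, log_norm_smul, norm_mul, norm_zpow, Complex.norm_ofNat,
    Real.log_mul (zpow_ne_zero _ three_ne_zero) (norm_ne_zero_iff.mpr hs), Real.log_zpow]
  field_simp
  ring

/-- The compact fundamental annulus of the action on the punctured plane. -/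
def annulus : Set puncturedPlane := {z | 1 ≤ ‖z.1‖ ∧ ‖z.1‖ ≤ 2}

theorem isCompact_annulus : IsCompact annulus := by
  have : ProperSpace (EuclideanSpace ℂ (Fin 2)) := FiniteDimensional.proper_rclike ℂ _
  have h : IsCompact {z : EuclideanSpace ℂ (Fin 2) | 1 ≤ ‖z‖ ∧ ‖z‖ ≤ 2} := by
    refine (isCompact_closedBall (0 : EuclideanSpace ℂ (Fin 2)) 2).of_isClosed_subset ?_ ?_
    · exact (isClosed_le continuous_const continuous_norm).inter
        (isClosed_le continuous_norm continuous_const)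
    · exact fun z hz ↦ mem_closedBall_zero_iff.mpr hz.2
  refine IsInducing.subtypeVal.isCompact_preimage' h ?_
  rintro z ⟨hz, -⟩
  refine ⟨⟨z, ?_⟩, rfl⟩
  rintro rfl
  norm_num at hz

theorem exists_smul_mem_annulus (z : puncturedPlane) : ∃ γ : Deck, γ • z ∈ annulus := by
  obtain ⟨n, h1, h2⟩ := exists_mem_Ico_zpow (norm_pos_iff.mpr (ne_zero z)) (one_lt_two (α := ℝ))
  obtain ⟨γ, hγ⟩ : ∃ γ : Deck, γ.exponent = -n := ⟨Multiplicative.ofAdd (-n), rfl⟩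
  refine ⟨γ, ?_⟩
  have h : ‖(γ • z).1‖ = ((2 : ℝ) ^ n)⁻¹ * ‖z.1‖ := by
    rw [coe_smul, norm_smul, norm_zpow, Complex.norm_ofNat, hγ, zpow_neg]
  have hpos : (0 : ℝ) < 2 ^ n := by positivity
  rw [annulus, mem_ofPred_eq, h, inv_mul_eq_div, le_div_iff₀ hpos, div_le_iff₀ hpos, one_mul]
  rw [zpow_add₀ two_ne_zero, zpow_one] at h2
  exact ⟨h1, by linarith⟩

/-- By invariance it suffices to maximize over `z` in the fundamental annulus, where the complement
of `D` becomes a compact set on which `height` is continuous. -/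
theorem exists_isMax_height {D : Set TotalSpace} (hD : IsOpen D)
    (hsub : closure discBundle ⊆ D) (hne : D ≠ univ) :
    ∃ (z₀ : puncturedPlane) (s₀ : ℂ), s₀ ≠ 0 ∧ point z₀ (cayley • (s₀ : OnePoint ℂ)) ∉ D ∧
      ∀ (z : puncturedPlane) (s : ℂ), s ≠ 0 → point z (cayley • (s : OnePoint ℂ)) ∉ D →
        height z s ≤ height z₀ s₀ := by
  have hcoord : ∀ z v, point z v ∉ D → ∃ s : ℂ, s ≠ 0 ∧ v = cayley • (s : OnePoint ℂ) := by
    intro z v h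
    obtain ⟨s, hs, rfl⟩ := notMem_closedUnitDisc_iff_cayley.mp
      fun hv ↦ h (hsub (point_mem_closure_discBundle.mpr hv))
    exact ⟨s, by rintro rfl; simp at hs, rfl⟩
  have hc : Continuous (fun x : OnePoint ℂ ↦ cayley • x) :=
    (RiemannSphere.contMDiff_smul cayley).continuous
  have hK : IsCompact {x : puncturedPlane × OnePoint ℂ |
      x ∈ annulus ×ˢ univ ∧ point x.1 (cayley • x.2) ∉ D} := by
    refine (isCompact_annulus.prod isCompact_univ).inter_right ?_
    exact (hD.preimage (continuous_point.comp
      (continuous_fst.prodMk (hc.comp continuous_snd)))).isClosed_compl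
  have hind : IsInducing (fun x : puncturedPlane × ℂ ↦ (x.1, (x.2 : OnePoint ℂ))) :=
    IsInducing.id.prodMap OnePoint.isOpenEmbedding_coe.isInducing
  have hK' : IsCompact {x : puncturedPlane × ℂ |
      x.1 ∈ annulus ∧ point x.1 (cayley • (x.2 : OnePoint ℂ)) ∉ D} := by
    -- Compactness is first obtained in the full sphere. It descends to finite `s` because the set
    -- misses `s = ∞`, a point of the closed disc.
    have h := hind.isCompact_preimage' hK <| by
      rintro ⟨z, x⟩ ⟨-, hx⟩
      obtain ⟨s, -, hs⟩ := hcoord _ _ hx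
      exact ⟨(z, s), Prod.ext rfl (MulAction.injective cayley hs).symm⟩
    convert h using 1
    ext x
    simp
  have hs0 : ∀ (z : puncturedPlane) (s : ℂ), point z (cayley • (s : OnePoint ℂ)) ∉ D → s ≠ 0 := by
    intro z s h
    obtain ⟨s', hs', h'⟩ := hcoord _ _ h
    rwa [OnePoint.coe_injective (MulAction.injective cayley h')]
  have hmem : ∀ (z : puncturedPlane) (s : ℂ), point z (cayley • (s : OnePoint ℂ)) ∉ D →
      ∃ γ : Deck, γ • z ∈ annulus ∧
        point (γ • z) (cayley • (((3 : ℂ) ^ γ.exponent * s : ℂ) : OnePoint ℂ)) ∉ D := by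
    intro z s h
    obtain ⟨γ, hγ⟩ := exists_smul_mem_annulus z
    refine ⟨γ, hγ, ?_⟩
    rwa [← smul_cayley_smul, point_smul]
  obtain ⟨b, hb⟩ := (ne_univ_iff_exists_notMem D).mp hne
  obtain ⟨z, v, rfl⟩ := exists_point_eq b
  obtain ⟨s, -, rfl⟩ := hcoord z v hb
  obtain ⟨γ, hγ⟩ := hmem z s hb
  have hcont : ContinuousOn (fun x : puncturedPlane × ℂ ↦ height x.1 x.2)
      {x | x.1 ∈ annulus ∧ point x.1 (cayley • (x.2 : OnePoint ℂ)) ∉ D} := by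
    refine ContinuousOn.sub (continuousOn_const.mul (ContinuousOn.log (by fun_prop) ?_))
      (ContinuousOn.log (by fun_prop) ?_)
    · exact fun x _ ↦ norm_ne_zero_iff.mpr (ne_zero x.1)
    · exact fun x hx ↦ norm_ne_zero_iff.mpr (hs0 x.1 x.2 hx.2)
  obtain ⟨⟨z₀, s₀⟩, h₀, hmax⟩ :=
    hK'.exists_isMaxOn ⟨(γ • z, (3 : ℂ) ^ γ.exponent * s), hγ⟩ hcont
  refine ⟨z₀, s₀, hs0 z₀ s₀ h₀.2, h₀.2, fun z s hs h ↦ ?_⟩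
  obtain ⟨γ, hγ⟩ := hmem z s h
  rw [← height_smul γ z hs]
  exact isMaxOn_iff.mp hmax (γ • z, (3 : ℂ) ^ γ.exponent * s) hγ

/-- The only pseudoconvex domain that contains the closed disc bundle is the total space. -/
theorem eq_univ_of_isPseudoconvexDomain {D : Set TotalSpace}
    (hD : SCV.IsPseudoconvexDomain model D) (hsub : closure discBundle ⊆ D) : D = univ := by
  by_contra hne
  obtain ⟨hopen, -, hpsc⟩ := hD
  obtain ⟨z₀, s₀, hs₀, hp, hmax⟩ := exists_isMax_height hopen hsub hne
  have hc : Continuous (fun x : OnePoint ℂ ↦ cayley • x) :=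
    (RiemannSphere.contMDiff_smul cayley).continuous
  -- The parameter `ζ` moves along the orthogonal line, while `t` shrinks `s₀`; both raise the
  -- height above its maximum.
  set F : ℝ → ℂ → TotalSpace := fun t ζ ↦
    point (normalLine z₀ ζ) (cayley • ((Real.exp (-t) * s₀ : ℂ) : OnePoint ℂ)) with hFdef
  have hF : Continuous (fun p : ℝ × ℂ ↦ F p.1 p.2) := by
    refine continuous_point.comp (Continuous.prodMk ?_ ?_)
    · exact (contMDiff_normalLine z₀).continuous.comp continuous_snd
    · exact hc.comp (OnePoint.continuous_coe.comp (by fun_prop))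
  have hF0 : F 0 0 = point z₀ (cayley • (s₀ : OnePoint ℂ)) := by simp [hFdef, normalLine_zero]
  have hFd : ∀ t, MDifferentiable 𝓘(ℂ) model (F t) := by
    intro t
    have h1 : ContMDiff 𝓘(ℂ) model ω (fun ζ ↦
        ((normalLine z₀ ζ, cayley • ((Real.exp (-t) * s₀ : ℂ) : OnePoint ℂ)) : Cover)) :=
      (contMDiff_normalLine z₀).prodMk contMDiff_const
    exact ((MulAction.contMDiff_quotientMk model ω contMDiff_smul).comp h1).mdifferentiable
      (by simp)
  have hFD : ∀ t ζ, 0 ≤ t → 0 < t ∨ ζ ≠ 0 → F t ζ ∈ D := by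
    intro t ζ ht h
    by_contra hn
    have he : (Real.exp (-t) : ℂ) ≠ 0 := by exact_mod_cast (Real.exp_pos _).ne'
    -- The height at `F t ζ` exceeds the maximum by `(log 3 / log 2) * log (1 + ‖ζ‖ ^ 2) / 2 + t`,
    -- which is positive unless `t = 0` and `ζ = 0`.
    have h1 := hmax _ _ (mul_ne_zero he hs₀) hn
    rw [height, height, log_norm_normalLine, norm_mul,
      Real.log_mul (norm_ne_zero_iff.mpr he) (norm_ne_zero_iff.mpr hs₀), Complex.norm_real,
      Real.norm_eq_abs, Real.abs_exp, Real.log_exp] at h1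
    have h2 : 0 < Real.log 3 / Real.log 2 :=
      div_pos (Real.log_pos (by norm_num)) (Real.log_pos one_lt_two)
    have h3 : 0 ≤ Real.log (1 + ‖ζ‖ ^ 2) := Real.log_nonneg (by nlinarith [sq_nonneg ‖ζ‖])
    rcases h with h | h
    · nlinarith
    · have h4 : 0 < Real.log (1 + ‖ζ‖ ^ 2) := by
        refine Real.log_pos ?_
        have := norm_pos_iff.mpr h
        nlinarith
      nlinarith
  have hfr : F 0 0 ∈ frontier D := by
    rw [hopen.frontier_eq]
    refine ⟨?_, by rwa [hF0]⟩
    have hlim : Filter.Tendsto (fun t ↦ F t 0) (𝓝[>] 0) (𝓝 (F 0 0)) :=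
      ((hF.comp (Continuous.prodMk_left (0 : ℂ))).tendsto 0).mono_left nhdsWithin_le_nhds
    refine mem_closure_of_tendsto hlim ?_
    filter_upwards [self_mem_nhdsWithin] with t ht using hFD t 0 (le_of_lt ht) (Or.inl ht)
  obtain ⟨U, hU, hpU, -, hex⟩ := hpsc _ hfr
  obtain ⟨r, hr, hball⟩ := Metric.mem_nhds_iff.mp
    ((hU.preimage hF).mem_nhds (show ((0 : ℝ), (0 : ℂ)) ∈ _ from hpU))
  have hr2 : 0 < r / 2 := half_pos hr
  -- Scaling `ζ` by `r / 2` and taking `t ≤ r / 2` keeps the parameters in the ball of radius `r`,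
  -- hence the discs in `U`.
  have key := hex.mem_of_family_of_discs (fun t ζ ↦ F t ((r / 2 : ℝ) * ζ)) hr2
    (hF.comp (continuous_fst.prodMk (by fun_prop)))
    (fun t ↦ (hFd t).comp (I' := 𝓘(ℂ)) (by
      exact (by fun_prop : Differentiable ℂ fun ζ : ℂ ↦ ((r / 2 : ℝ) : ℂ) * ζ).mdifferentiable))
    (by
      intro t ht ζ hζ h
      have hmem : (t, ((r / 2 : ℝ) : ℂ) * ζ) ∈ Metric.ball ((0 : ℝ), (0 : ℂ)) r := by
        rw [mem_closedBall_zero_iff] at hζ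
        rw [mem_ball_iff_norm, Prod.mk_zero_zero, sub_zero, Prod.norm_mk, max_lt_iff, norm_mul,
          Complex.norm_real, Real.norm_of_nonneg ht.1, Real.norm_of_nonneg hr2.le]
        constructor
        · linarith [ht.2]
        · nlinarith
      exact ⟨hball hmem, hFD _ _ ht.1 (h.imp_right fun h ↦
        mul_ne_zero (by exact_mod_cast hr2.ne') h)⟩)
  simp only [mul_zero] at key
  rw [hF0] at key
  exact hp key.2

end HopfBundle

/-! ### The theorem -/

theorem mainTheorem1 :
    IsOpen HopfBundle.discBundle ∧
    IsConnected HopfBundle.discBundle ∧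
    frontier HopfBundle.discBundle = HopfBundle.circleBundle ∧
    closure HopfBundle.discBundle = HopfBundle.discBundle ∪ HopfBundle.circleBundle ∧
    SCV.HasRealAnalyticLeviFlatBoundary HopfBundle.model HopfBundle.discBundle ∧
    (¬ ∃ 𝒩 : Set (Set HopfBundle.TotalSpace),
      (∀ D ∈ 𝒩, SCV.IsPseudoconvexDomain HopfBundle.model D ∧
        closure HopfBundle.discBundle ⊆ D) ∧
      ∀ V : Set HopfBundle.TotalSpace, IsOpen V → closure HopfBundle.discBundle ⊆ V →
        ∃ D ∈ 𝒩, D ⊆ V) ∧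
    ¬ ∃ D : ℕ → Set HopfBundle.TotalSpace, Antitone D ∧
      (∀ n, SCV.IsPseudoconvexDomain HopfBundle.model (D n)) ∧
      ⋂ n, D n = closure HopfBundle.discBundle := by
  obtain ⟨⟨b, hb⟩⟩ : Nonempty {b // b ∉ closure HopfBundle.discBundle} := by
    obtain ⟨_, z, -⟩ := HopfBundle.isConnected_discBundle.nonempty
    exact ⟨HopfBundle.point z OnePoint.infty, fun h ↦
      HopfBundle.infty_notMem_closedUnitDisc (HopfBundle.point_mem_closure_discBundle.mp h)⟩
  refine ⟨HopfBundle.isOpen_discBundle, HopfBundle.isConnected_discBundle,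
    HopfBundle.frontier_discBundle, ?_,
    HopfBundle.hasRealAnalyticLeviFlatBoundary_discBundle, ?_, ?_⟩
  · rw [closure_eq_self_union_frontier, HopfBundle.frontier_discBundle]
  · rintro ⟨𝒩, h𝒩, hbasis⟩
    -- Removing one point outside the closure gives an open neighbourhood that cannot contain the
    -- total space.
    obtain ⟨D, hD, hDV⟩ := hbasis {b}ᶜ isOpen_compl_singleton
      (Set.subset_compl_singleton_iff.mpr hb)
    rw [HopfBundle.eq_univ_of_isPseudoconvexDomain (h𝒩 D hD).1 (h𝒩 D hD).2] at hDV
    exact hDV (Set.mem_univ b) rfl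
  · rintro ⟨D, -, hD, hinter⟩
    refine hb (hinter ▸ Set.mem_iInter.mpr fun n ↦ ?_)
    rw [HopfBundle.eq_univ_of_isPseudoconvexDomain (hD n) (hinter ▸ Set.iInter_subset D n)]
    trivial
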